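/- Let $\mathbb{S}^1=\mathbb{R}/\mathbb{Z}$ and let $f\colon\mathbb{S}^1\to\mathbb{R}$ be continuous and non-constant. Then there is a homeomorphism $\underline{\tau}\colon\mathbb{S}^1\to\mathbb{S}^1$ (a time change) such that $$\overline{\dim}_B\,\Gamma(f\circ\underline{\tau})\;\ge\;2-\frac{1}{\overline{\dim}_{MB}\,\mathcal{T}(f)},\qquad\text{where } \tfrac1\infty=0.$$ Here $\Gamma(g)=\{(x,g(x)):x\in\mathbb{S}^1\}\subset\mathbb{S}^1\times\mathbb{R}$ is the graph of $g$. For a totally bounded metric space $X$, let $N_r(X)$ be the minimal number of sets of diameter at most $r$ needed to cover $X$; then $$\overline{\dim}_B X=\limsup_{r\to0^+}\frac{\log N_r(X)}{-\log r}\in[0,\infty],\qquad \overline{\dim}_{MB}X=\inf\Big\{\sup_{i\in\mathbb{N}}\overline{\dim}_B X_i \;:\; X=\bigcup_{i\in\mathbb{N}}X_i\Big\}$$ are the upper box dimension and the modified upper box dimension, with $\overline{\dim}_B\emptyset=0$. The real tree $\mathcal{T}(f)$ is defined as follows. Let $a\in\mathbb{S}^1$ be a point at which $f$ attains its minimum and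 put $\tilde f(x)=f(x+a)-f(a)$ for $x\in[0,1]$, so that $\tilde f\ge0$ and $\tilde f(0)=\tilde f(1)=0$. For $0\le x\le y\le1$ set $$d(x,y)=d(y,x)=\tilde f(x)+\tilde f(y)-2\min_{z\in[x,y]}\tilde f(z).$$ This is a pseudometric on $[0,1]$, and $\mathcal{T}(f)$ is the metric space obtained from $([0,1],d)$ by identifying points at distance $0$. -/

import Mathlib

open Set Filter Topology
open scoped ENNReal unitInterval

noncomputable section

/-! ## Box dimensions -/

/-- `N_r(A)`: the minimal number (possibly `∞`) of sets of diameter at most `r` covering `A`. -/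
def boxCount {X : Type*} [PseudoMetricSpace X] (A : Set X) (r : ℝ) : ℕ∞ :=
  ⨅ (C : Set (Set X)) (_ : A ⊆ ⋃₀ C) (_ : ∀ U ∈ C, Metric.ediam U ≤ ENNReal.ofReal r), C.encard

/-- The upper box dimension `limsup_{r → 0+} log N_r(A) / (-log r)`, with values in `[0, ∞]`.
For nonempty `A` and `0 < r < 1` the quotient lies in `[0, ∞]`, so that `EReal.toENNReal` is only a
change of type; for `A = ∅`, where `log 0 = -∞`, the value is `0`. -/
def upperBoxDim {X : Type*} [PseudoMetricSpace X] (A : Set X) : ℝ≥0∞ :=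
  limsup (fun r : ℝ =>
    (ENNReal.log ((boxCount A r : ℕ∞) : ℝ≥0∞) / ((-Real.log r : ℝ) : EReal)).toENNReal) (𝓝[>] 0)

/-- The modified upper box dimension of a space: the infimum, over all countable covers
`X = ⋃ i, A i`, of `sup_i` of the upper box dimension of `A i`. -/
def modifiedUpperBoxDim (X : Type*) [PseudoMetricSpace X] : ℝ≥0∞ :=
  ⨅ (A : ℕ → Set X) (_ : ⋃ i, A i = univ), ⨆ i, upperBoxDim (A i)

/-! ## The real tree of an excursion function -/

/-- A continuous function `f : [0,1] → [0,∞)` with `f 0 = 0 = f 1`. -/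
structure ExcursionFunction where
  toMap : C(I, ℝ)
  map_zero : toMap 0 = 0
  map_one : toMap 1 = 0
  nonneg : ∀ x, 0 ≤ toMap x

namespace ExcursionFunction

/-- The minimum of `f` over the closed interval with end points `x` and `y` (in either order). -/
def intervalMin (f : ExcursionFunction) (x y : I) : ℝ :=
  sInf (f.toMap '' uIcc x y)

/-- `d_f(x, y) = f(x) + f(y) - 2 min_{[x,y]} f`. -/
def treeDist (f : ExcursionFunction) (x y : I) : ℝ :=
  f.toMap x + f.toMap y - 2 * f.intervalMin x y

theorem intervalMin_le (f : ExcursionFunction) {x y z : I} (hz : z ∈ uIcc x y) :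
    f.intervalMin x y ≤ f.toMap z :=
  csInf_le ⟨0, by rintro _ ⟨w, -, rfl⟩; exact f.nonneg w⟩ (mem_image_of_mem _ hz)

theorem le_intervalMin (f : ExcursionFunction) {x y : I} {c : ℝ}
    (h : ∀ z ∈ uIcc x y, c ≤ f.toMap z) : c ≤ f.intervalMin x y :=
  le_csInf (nonempty_uIcc.image _) (by rintro _ ⟨w, hw, rfl⟩; exact h w hw)

/-- The infimum in `intervalMin` is attained. -/
theorem exists_eq_intervalMin (f : ExcursionFunction) (x y : I) :
    ∃ z ∈ uIcc x y, f.toMap z = f.intervalMin x y :=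
  (isCompact_uIcc.image f.toMap.continuous).sInf_mem (nonempty_uIcc.image _)

theorem treeDist_self (f : ExcursionFunction) (x : I) : f.treeDist x x = 0 := by
  simp [treeDist, intervalMin]; ring

theorem treeDist_comm (f : ExcursionFunction) (x y : I) : f.treeDist x y = f.treeDist y x := by
  simp only [treeDist, intervalMin, uIcc_comm x y]; ring

theorem treeDist_triangle (f : ExcursionFunction) (x y z : I) :
    f.treeDist x z ≤ f.treeDist x y + f.treeDist y z := by
  have h1 : f.intervalMin x y ≤ f.toMap y := f.intervalMin_le right_mem_uIcc
  have h2 : f.intervalMin y z ≤ f.toMap y := f.intervalMin_le left_mem_uIcc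
  have h3 : min (f.intervalMin x y) (f.intervalMin y z) ≤ f.intervalMin x z := by
    refine f.le_intervalMin fun w hw => ?_
    rcases uIcc_subset_uIcc_union_uIcc (b := y) hw with h | h
    · exact (min_le_left _ _).trans (f.intervalMin_le h)
    · exact (min_le_right _ _).trans (f.intervalMin_le h)
  have h4 := min_add_max (f.intervalMin x y) (f.intervalMin y z)
  have h5 := max_le h1 h2
  simp only [treeDist]
  linarith

/-- The interval `[0,1]`, to be endowed with the pseudometric `d_f`. -/
def TreePoints (_f : ExcursionFunction) : Type := I

instance (f : ExcursionFunction) : PseudoMetricSpace f.TreePoints where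
  dist x y := f.treeDist x y
  dist_self x := f.treeDist_self x
  dist_comm x y := f.treeDist_comm x y
  dist_triangle x y z := f.treeDist_triangle x y z

/-- The real tree of an excursion function: the metric space obtained from `([0,1], d_f)` by
identifying points at distance zero. -/
abbrev Tree (f : ExcursionFunction) : Type := SeparationQuotient f.TreePoints

end ExcursionFunction

/-! ## Functions on the circle `ℝ / ℤ` -/

theorem exists_circle_argmin (f : C(UnitAddCircle, ℝ)) : ∃ a, ∀ x, f a ≤ f x := by
  obtain ⟨a, -, ha⟩ := isCompact_univ.exists_isMinOn univ_nonempty f.continuous.continuousOn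
  exact ⟨a, fun x => ha (mem_univ x)⟩

/-- A point of the circle at which `f` attains its minimum. -/
def circleArgmin (f : C(UnitAddCircle, ℝ)) : UnitAddCircle :=
  (exists_circle_argmin f).choose

theorem circleArgmin_le (f : C(UnitAddCircle, ℝ)) (x : UnitAddCircle) :
    f (circleArgmin f) ≤ f x :=
  (exists_circle_argmin f).choose_spec x

/-- The excursion function `x ↦ f (x + a) - f a`, where `a` is a point at which `f` attains its
minimum. -/
def circleExcursion (f : C(UnitAddCircle, ℝ)) : ExcursionFunction where
  toMap :=
    { toFun := fun x => f (((x : ℝ) : UnitAddCircle) + circleArgmin f) - f (circleArgmin f)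
      continuous_toFun := by
        have h : Continuous fun x : I => ((x : ℝ) : UnitAddCircle) :=
          (AddCircle.continuous_mk' 1).comp continuous_subtype_val
        fun_prop }
  map_zero := by simp
  map_one := by
    have h : ((1 : ℝ) : UnitAddCircle) = 0 := AddCircle.coe_period 1
    simp [h]
  nonneg x := sub_nonneg.2 (circleArgmin_le f _)

/-- The real tree `𝒯(f)` of a continuous function on the circle. -/
abbrev circleTree (f : C(UnitAddCircle, ℝ)) : Type := (circleExcursion f).Tree

/-- The graph `Γ(f) = {(x, f x)} ⊆ S¹ × ℝ`. The product carries Mathlib's (maximum) product metric,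
which is bi-Lipschitz equivalent to the Euclidean one, so that box dimensions are the same. -/
def circleGraph (f : C(UnitAddCircle, ℝ)) : Set (UnitAddCircle × ℝ) :=
  range fun x => (x, f x)

end

/-- An `r`-separated family in `A` bounds the box count of `A` from below. -/
theorem card_le_boxCount {X ι : Type*} [PseudoMetricSpace X] [Fintype ι] {A : Set X} {r : ℝ}
    (hr : 0 ≤ r) (P : ι → X) (hP : ∀ i, P i ∈ A) (hsep : ∀ i j, i ≠ j → r < dist (P i) (P j)) :
    (Fintype.card ι : ℕ∞) ≤ boxCount A r := by
  refine le_iInf fun C => le_iInf fun hA => le_iInf fun hC => ?_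
  have h : ∀ i, ∃ U ∈ C, P i ∈ U := fun i => by simpa using hA (hP i)
  choose U hUC hPU using h
  have hinj : Function.Injective U := by
    intro i j hij
    by_contra hne
    have h1 : edist (P i) (P j) ≤ ENNReal.ofReal r :=
      (Metric.edist_le_ediam_of_mem (hPU i) (hij ▸ hPU j)).trans (hC _ (hUC i))
    rw [edist_dist, ENNReal.ofReal_le_ofReal_iff hr] at h1
    exact (hsep i j hne).not_ge h1
  calc (Fintype.card ι : ℕ∞) = ENat.card ι := by simp
    _ ≤ (range U).encard := hinj.encard_range
    _ ≤ C.encard := encard_le_encard (range_subset_iff.2 hUC)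

theorem boxCount_le_card {X ι : Type*} [PseudoMetricSpace X] [Fintype ι] {A : Set X} {r : ℝ}
    (U : ι → Set X) (hA : A ⊆ ⋃ i, U i) (hU : ∀ i, Metric.ediam (U i) ≤ ENNReal.ofReal r) :
    boxCount A r ≤ Fintype.card ι := by
  have h : boxCount A r ≤ (range U).encard :=
    iInf_le_of_le (range U) <| iInf₂_le_of_le (hA.trans_eq (sUnion_range U).symm)
      (by rintro _ ⟨i, rfl⟩; exact hU i) le_rfl
  refine h.trans ?_
  rw [← image_univ]
  refine (encard_image_le _ _).trans ?_
  simp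

theorem ofReal_rpow_neg_le_of_lt_log_div {N : ℝ≥0∞} {r p : ℝ} (hr : 0 < r) (hr1 : r < 1)
    (h : ENNReal.ofReal p < (ENNReal.log N / ((-Real.log r : ℝ) : EReal)).toENNReal) :
    ENNReal.ofReal (r ^ (-p)) ≤ N := by
  have hl : 0 < -Real.log r := neg_pos.2 (Real.log_neg hr hr1)
  have h1 : (p : EReal) < ENNReal.log N / ((-Real.log r : ℝ) : EReal) := by
    by_contra hcon
    have := EReal.toENNReal_le_toENNReal (not_lt.1 hcon)
    exact absurd h (not_lt.2 (by simpa using this))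
  rw [EReal.lt_div_iff (by exact_mod_cast hl) (EReal.coe_ne_top _)] at h1
  rw [← ENNReal.log_le_log_iff, ENNReal.log_ofReal_of_pos (Real.rpow_pos_of_pos hr _),
    Real.log_rpow hr]
  refine le_trans ?_ h1.le
  norm_cast
  linarith

theorem ofReal_le_log_div_of_rpow_neg_le {N : ℝ≥0∞} {r p : ℝ} (hr : 0 < r) (hr1 : r < 1)
    (h : ENNReal.ofReal (r ^ (-p)) ≤ N) :
    ENNReal.ofReal p ≤ (ENNReal.log N / ((-Real.log r : ℝ) : EReal)).toENNReal := by
  have hl : 0 < -Real.log r := neg_pos.2 (Real.log_neg hr hr1)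
  rw [← EReal.real_coe_toENNReal]
  refine EReal.toENNReal_le_toENNReal ?_
  rw [EReal.le_div_iff_mul_le (by exact_mod_cast hl) (EReal.coe_ne_top _)]
  rw [← ENNReal.log_le_log_iff, ENNReal.log_ofReal_of_pos (Real.rpow_pos_of_pos hr _),
    Real.log_rpow hr] at h
  refine le_trans (le_of_eq ?_) h
  norm_cast
  ring

theorem modifiedUpperBoxDim_le_upperBoxDim_univ (X : Type*) [PseudoMetricSpace X] :
    modifiedUpperBoxDim X ≤ upperBoxDim (univ : Set X) :=
  iInf_le_of_le (fun _ => univ) <| iInf_le_of_le (iUnion_const _) <| iSup_const.le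

/-- Partition of `[0, 1]` into successive intervals on which a continuous function first moves by
`δ`. -/
theorem exists_oscillation_partition {h : ℝ → ℝ} (hh : Continuous h) {δ : ℝ} (hδ : 0 < δ) :
    ∃ (M : ℕ) (t : ℕ → ℝ), Monotone t ∧ t 0 = 0 ∧ t M = 1 ∧ (∀ i < M, t i < t (i + 1)) ∧
      (∀ i, i + 1 < M → δ ≤ |h (t (i + 1)) - h (t i)|) ∧
      ∀ i < M, ∀ x ∈ Ico (t i) (t (i + 1)), |h x - h (t i)| < δ := by
  have huc : UniformContinuousOn h (Icc 0 1) :=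
    isCompact_Icc.uniformContinuousOn_of_continuous hh.continuousOn
  obtain ⟨η, hη, hunif⟩ := Metric.uniformContinuousOn_iff.1 huc δ hδ
  have hstep : ∀ a : ℝ, ∃ b, (a ∈ Ico (0 : ℝ) 1 → b ≤ 1 ∧ min 1 (a + η) ≤ b ∧
      (b < 1 → δ ≤ |h b - h a|) ∧ ∀ x ∈ Ico a b, |h x - h a| < δ) ∧ (¬ a ∈ Ico (0 : ℝ) 1 → b = a) := by
    intro a
    by_cases ha : a ∈ Ico (0 : ℝ) 1
    swap
    · exact ⟨a, fun h => absurd h ha, fun _ => rfl⟩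
    set S : Set ℝ := {u | u ∈ Icc a 1 ∧ (u = 1 ∨ δ ≤ |h u - h a|)} with hS
    have hSc : IsClosed S := by
      refine isClosed_Icc.inter (IsClosed.union isClosed_singleton ?_)
      exact isClosed_le continuous_const (hh.sub continuous_const).abs
    have hSb : BddBelow S := ⟨a, fun u hu => hu.1.1⟩
    have hSn : S.Nonempty := ⟨1, ⟨ha.2.le, le_rfl⟩, Or.inl rfl⟩
    have hmem := hSc.csInf_mem hSn hSb
    refine ⟨sInf S, fun _ => ⟨hmem.1.2, ?_, ?_, ?_⟩, fun h => absurd ha h⟩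
    · rcases hmem.2 with h1 | h1
      · rw [h1]; exact min_le_left _ _
      · refine (min_le_right _ _).trans ?_
        by_contra hlt
        have h2 := hunif (sInf S) ⟨ha.1.trans hmem.1.1, hmem.1.2⟩ a ⟨ha.1, ha.2.le⟩ (by
          rw [Real.dist_eq, abs_of_nonneg (sub_nonneg.2 hmem.1.1)]; linarith)
        rw [Real.dist_eq] at h2
        linarith
    · intro hlt
      exact hmem.2.resolve_left hlt.ne
    · intro x hx
      by_contra hcon
      exact hx.2.not_ge (csInf_le hSb ⟨⟨hx.1, hx.2.le.trans hmem.1.2⟩, Or.inr (not_lt.1 hcon)⟩)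
  choose next hnext hfix using hstep
  set t : ℕ → ℝ := fun n => next^[n] 0 with ht
  have ht0 : t 0 = 0 := rfl
  have hts : ∀ n, t (n + 1) = next (t n) := fun n => Function.iterate_succ_apply' _ _ _
  have htI : ∀ n, t n ∈ Icc (0 : ℝ) 1 := by
    intro n
    induction n with
    | zero => simp [ht0]
    | succ n ih =>
      rw [hts]
      by_cases hn : t n ∈ Ico (0 : ℝ) 1
      · obtain ⟨h1, h2, -⟩ := hnext _ hn
        exact ⟨(le_min zero_le_one (by linarith [hn.1])).trans h2, h1⟩
      · rwa [hfix _ hn]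
  have hlt : ∀ n, t n < 1 → t n < t (n + 1) := by
    intro n hn
    rw [hts]
    exact (lt_min hn (by linarith)).trans_le (hnext _ ⟨(htI n).1, hn⟩).2.1
  have hmono : Monotone t := by
    refine monotone_nat_of_le_succ fun n => ?_
    rcases (htI n).2.lt_or_eq with h1 | h1
    · exact (hlt n h1).le
    · rw [hts, hfix _ (by simp [h1])]
  have hgrow : ∀ n : ℕ, min 1 (n * η) ≤ t n := by
    intro n
    induction n with
    | zero => simp [ht0]
    | succ n ih =>
      rcases (htI n).2.lt_or_eq with h1 | h1
      · rw [hts]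
        refine le_trans ?_ (hnext _ ⟨(htI n).1, h1⟩).2.1
        refine le_min (min_le_left _ _) ((min_le_right _ _).trans ?_)
        have : (n : ℝ) * η ≤ t n := (min_le_iff.1 ih).resolve_left (not_le.2 h1)
        push_cast
        linarith
      · exact (min_le_left _ _).trans (h1 ▸ hmono n.le_succ)
  have hex : ∃ n, t n = 1 := by
    obtain ⟨n, hn⟩ := exists_nat_gt (1 / η)
    refine ⟨n, (htI n).2.antisymm (le_trans (le_min le_rfl ?_) (hgrow n))⟩
    rw [div_lt_iff₀ hη] at hn
    exact hn.le
  classical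
  have hM : ∀ i < Nat.find hex, t i ∈ Ico (0 : ℝ) 1 := fun i hi =>
    ⟨(htI i).1, lt_of_le_of_ne (htI i).2 (Nat.find_min hex hi)⟩
  refine ⟨Nat.find hex, t, hmono, ht0, Nat.find_spec hex, fun i hi => hlt i (hM i hi).2, ?_, ?_⟩
  · intro i hi
    rw [hts]
    refine (hnext _ (hM i (by omega))).2.2.1 ?_
    rw [← hts]
    exact (hM _ hi).2
  · intro i hi
    rw [hts]
    exact (hnext _ (hM i hi)).2.2.2

/-- An orientation preserving homeomorphism of `[0, 1]` descends to the circle. -/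
theorem exists_circle_homeomorph {G : ℝ → ℝ} (hG : Continuous G) (hmono : StrictMono G)
    (h0 : G 0 = 0) (h1 : G 1 = 1) :
    ∃ φ : UnitAddCircle ≃ₜ UnitAddCircle,
      ∀ x ∈ Icc (0 : ℝ) 1, φ (x : UnitAddCircle) = (G x : UnitAddCircle) := by
  have h01 : ((1 : ℝ) : UnitAddCircle) = ((0 : ℝ) : UnitAddCircle) := by
    simp [AddCircle.coe_period (1 : ℝ)]
  have hc : Continuous ((fun x => (G x : UnitAddCircle)) ∘ Int.fract) := by
    refine ContinuousOn.comp_fract'' ?_ (by simp only [h0, h1, h01])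
    exact ((AddCircle.continuous_mk' 1).comp hG).continuousOn
  have hper : Function.Periodic ((fun x => (G x : UnitAddCircle)) ∘ Int.fract) (1 : ℝ) := by
    intro x; simp
  set φ : UnitAddCircle → UnitAddCircle := hper.lift with hφ
  have hφc : Continuous φ := by
    exact continuous_quot_lift _ hc
  have hφv : ∀ x ∈ Ico (0 : ℝ) 1, φ (x : UnitAddCircle) = (G x : UnitAddCircle) := by
    intro x hx
    have : φ (x : UnitAddCircle) = (G (Int.fract x) : UnitAddCircle) := hper.lift_coe x
    rwa [Int.fract_eq_self.2 hx] at this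
  have hrep : ∀ v : UnitAddCircle, ∃ x ∈ Ico (0 : ℝ) 1, (x : UnitAddCircle) = v := by
    intro v
    obtain ⟨x, rfl⟩ := QuotientAddGroup.mk_surjective v
    refine ⟨Int.fract x, ⟨Int.fract_nonneg x, Int.fract_lt_one x⟩, ?_⟩
    exact AddCircle.coe_fract x
  have hGI : ∀ x ∈ Ico (0 : ℝ) 1, G x ∈ Ico (0 : ℝ) (0 + 1) := by
    intro x hx
    rw [zero_add]
    exact ⟨h0 ▸ hmono.monotone hx.1, h1 ▸ hmono hx.2⟩
  have hbij : Function.Bijective φ := by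
    constructor
    · intro v w hvw
      obtain ⟨x, hx, rfl⟩ := hrep v
      obtain ⟨y, hy, rfl⟩ := hrep w
      rw [hφv x hx, hφv y hy, AddCircle.coe_eq_coe_iff_of_mem_Ico (hGI x hx) (hGI y hy)] at hvw
      rw [hmono.injective hvw]
    · intro w
      obtain ⟨y, hy, rfl⟩ := hrep w
      obtain ⟨x, hx, hxy⟩ := intermediate_value_Ico zero_le_one hG.continuousOn
        (by rwa [h0, h1] : y ∈ Ico (G 0) (G 1))
      exact ⟨x, by rw [hφv x hx, hxy]⟩
  refine ⟨Continuous.homeoOfEquivCompactToT2 (f := Equiv.ofBijective φ hbij) hφc, ?_⟩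
  intro x hx
  change φ x = _
  rcases hx.2.lt_or_eq with h | rfl
  · exact hφv x ⟨hx.1, h⟩
  · rw [h1, h01, hφv 0 (by simp), h0]

/-- A common change of time giving every interval of each of countably many finite families a
controlled share of the total time. -/
theorem exists_time_change (M : ℕ → ℕ) (t : ℕ → ℕ → ℝ) (hM : ∀ k, M k ≠ 0)
    (ht : ∀ k, Monotone (t k)) (ht0 : ∀ k, t k 0 = 0) (ht1 : ∀ k, t k (M k) = 1)
    (hlt : ∀ k, ∀ i < M k, t k i < t k (i + 1)) :
    ∃ G : ℝ → ℝ, Continuous G ∧ StrictMono G ∧ G 0 = 0 ∧ G 1 = 1 ∧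
      ∀ k, ∀ i < M k, (1 / 2) ^ (k + 2) / M k ≤ G (t k (i + 1)) - G (t k i) := by
  set c : ℕ → ℕ → ℝ → ℝ := fun k i x =>
    projIcc (0 : ℝ) 1 zero_le_one ((x - t k i) / (t k (i + 1) - t k i)) with hc
  have hcc : ∀ k i, Continuous (c k i) := fun k i =>
    continuous_subtype_val.comp (continuous_projIcc.comp (by fun_prop))
  have hcm : ∀ k, ∀ i, Monotone (c k i) := fun k i x y hxy => by
    refine monotone_projIcc (zero_le_one (α := ℝ)) ?_
    have := ht k i.le_succ
    have : 0 ≤ t k (i + 1) - t k i := sub_nonneg.2 this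
    gcongr
  have hcI : ∀ k i x, c k i x ∈ Icc (0 : ℝ) 1 := fun k i x => Subtype.coe_prop _
  have hcl : ∀ k i x, x ≤ t k i → c k i x = 0 := by
    intro k i x hx
    have : (x - t k i) / (t k (i + 1) - t k i) ≤ 0 :=
      div_nonpos_of_nonpos_of_nonneg (by linarith) (sub_nonneg.2 (ht k i.le_succ))
    simp only [hc, projIcc_of_le_left _ this]
  have hcr : ∀ k, ∀ i < M k, ∀ x, t k (i + 1) ≤ x → c k i x = 1 := by
    intro k i hi x hx
    have : 1 ≤ (x - t k i) / (t k (i + 1) - t k i) := by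
      rw [one_le_div (sub_pos.2 (hlt k i hi))]; linarith
    simp only [hc, projIcc_of_right_le _ this]
  have hM' : ∀ k, (0 : ℝ) < M k := fun k => by exact_mod_cast Nat.pos_of_ne_zero (hM k)
  set g : ℕ → ℝ → ℝ := fun k x => (∑ i ∈ Finset.range (M k), c k i x) / M k with hg
  have hgc : ∀ k, Continuous (g k) := fun k => by
    have := hcc k; simp only [hg]; fun_prop
  have hgm : ∀ k, Monotone (g k) := fun k x y hxy => by
    have := hM' k
    simp only [hg]
    gcongr with i
    exact hcm k i hxy
  have hgI : ∀ k x, g k x ∈ Icc (0 : ℝ) 1 := fun k x => by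
    refine ⟨div_nonneg (Finset.sum_nonneg fun i _ => (hcI k i x).1) (hM' k).le, ?_⟩
    simp only [hg]
    rw [div_le_one (hM' k)]
    simpa using Finset.sum_le_card_nsmul (Finset.range (M k)) _ 1 fun i _ => (hcI k i x).2
  have hg0 : ∀ k, g k 0 = 0 := fun k => by
    simp only [hg]
    rw [Finset.sum_eq_zero fun i _ => hcl k i 0 (ht0 k ▸ ht k i.zero_le), zero_div]
  have hg1 : ∀ k, g k 1 = 1 := fun k => by
    simp only [hg]
    rw [Finset.sum_congr rfl fun i hi => hcr k i (Finset.mem_range.1 hi) 1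
      (ht1 k ▸ ht k (Finset.mem_range.1 hi))]
    simpa using div_self (hM' k).ne'
  have hgj : ∀ k, ∀ i < M k, 1 / M k ≤ g k (t k (i + 1)) - g k (t k i) := by
    intro k i hi
    simp only [hg]
    rw [← sub_div, ← Finset.sum_sub_distrib]
    refine div_le_div_of_nonneg_right ?_ (hM' k).le
    refine le_trans (le_of_eq ?_) (Finset.single_le_sum
      (fun j _ => sub_nonneg.2 (hcm k j (ht k i.le_succ))) (Finset.mem_range.2 hi))
    rw [hcr k i hi _ le_rfl, hcl k i _ le_rfl, sub_zero]
  have hs : HasSum (fun k : ℕ => ((1 : ℝ) / 2) ^ (k + 2)) (1 / 2) := by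
    have := (hasSum_geometric_two).mul_right ((1 / 4 : ℝ))
    have h4 : (fun k : ℕ => ((1 : ℝ) / 2) ^ (k + 2)) = fun k => (1 / 2) ^ k * (1 / 4) := by
      funext k; rw [pow_add]; norm_num
    rw [h4]
    rwa [show (2 : ℝ) * (1 / 4) = 1 / 2 by norm_num] at this
  have hsum : ∀ x, Summable fun k => ((1 : ℝ) / 2) ^ (k + 2) * g k x := fun x =>
    Summable.of_nonneg_of_le (fun k => mul_nonneg (by positivity) (hgI k x).1)
      (fun k => mul_le_of_le_one_right (by positivity) (hgI k x).2) hs.summable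
  have hle : ∀ x y, x ≤ y → ∀ k, (1 / 2) ^ (k + 2) * (g k y - g k x) ≤
      ∑' k, ((1 : ℝ) / 2) ^ (k + 2) * g k y - ∑' k, ((1 : ℝ) / 2) ^ (k + 2) * g k x := by
    intro x y hxy k
    rw [← (hsum y).tsum_sub (hsum x)]
    simp only [← mul_sub]
    refine Summable.le_tsum (f := fun k => ((1 : ℝ) / 2) ^ (k + 2) * (g k y - g k x)) ?_ k
      fun j _ => mul_nonneg (by positivity) (sub_nonneg.2 (hgm j hxy))
    simpa only [mul_sub] using (hsum y).sub (hsum x)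
  refine ⟨fun x => 1 / 2 * x + ∑' k, (1 / 2) ^ (k + 2) * g k x, ?_, ?_, ?_, ?_, ?_⟩
  · refine (by fun_prop : Continuous fun x : ℝ => 1 / 2 * x).add (continuous_tsum
      (fun k => continuous_const.mul (hgc k)) hs.summable fun k x => ?_)
    rw [Real.norm_of_nonneg (mul_nonneg (by positivity) (hgI k x).1)]
    exact mul_le_of_le_one_right (by positivity) (hgI k x).2
  · intro x y hxy
    have h1 := hle x y hxy.le 0
    have h2 : 0 ≤ ((1 : ℝ) / 2) ^ (0 + 2) * (g 0 y - g 0 x) :=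
      mul_nonneg (by positivity) (sub_nonneg.2 (hgm 0 hxy.le))
    simp only
    linarith
  · simp [hg0]
  · simp only [hg1, mul_one, hs.tsum_eq]; norm_num
  · intro k i hi
    have h1 := hle _ _ (ht k i.le_succ) k
    have h2 := mul_le_mul_of_nonneg_left (hgj k i hi) (by positivity : (0 : ℝ) ≤ (1 / 2) ^ (k + 2))
    have h3 := ht k i.le_succ
    rw [mul_one_div] at h2
    simp only [Nat.succ_eq_add_one] at *
    linarith

theorem ExcursionFunction.treeDist_le_of_oscillation (f : ExcursionFunction) {x y : I} {c δ : ℝ}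
    (h : ∀ z ∈ uIcc x y, |f.toMap z - c| ≤ δ) : f.treeDist x y ≤ 4 * δ := by
  obtain ⟨z, hz, hzm⟩ := f.exists_eq_intervalMin x y
  have h1 := abs_le.1 (h x left_mem_uIcc)
  have h2 := abs_le.1 (h y right_mem_uIcc)
  have h3 := abs_le.1 (h z hz)
  rw [ExcursionFunction.treeDist, ← hzm]
  linarith

/-- The number of pieces of a partition into intervals of small oscillation bounds the box count
of the tree. -/
theorem ExcursionFunction.boxCount_tree_le (f : ExcursionFunction) {M : ℕ} {t : ℕ → ℝ} {δ : ℝ}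
    (hδ : 0 ≤ δ) {c : ℕ → ℝ} (ht0 : t 0 = 0) (htM : t M = 1)
    (hosc : ∀ i < M, ∀ x : I, (x : ℝ) ∈ Ico (t i) (t (i + 1)) → |f.toMap x - c i| ≤ δ) :
    boxCount (univ : Set f.Tree) (4 * δ) ≤ (M + 1 : ℕ) := by
  set V : Fin (M + 1) → Set I := fun i =>
    if (i : ℕ) < M then {x | (x : ℝ) ∈ Ico (t i) (t (i + 1))} else {1} with hV
  have hVd : ∀ i, ∀ x ∈ V i, ∀ y ∈ V i, f.treeDist x y ≤ 4 * δ := by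
    intro i x hx y hy
    by_cases hi : (i : ℕ) < M
    · simp only [hV, hi, if_true] at hx hy
      refine f.treeDist_le_of_oscillation (c := c i) fun z hz => hosc i hi z ?_
      have hoc : OrdConnected {x : I | (x : ℝ) ∈ Ico (t i) (t (i + 1))} :=
        ordConnected_Ico.preimage_mono (fun _ _ h => h)
      exact hoc.uIcc_subset hx hy hz
    · simp only [hV, hi, if_false, mem_singleton_iff] at hx hy
      rw [hx, hy, f.treeDist_self]
      positivity
  have hVc : ∀ x : I, ∃ i, x ∈ V i := by
    intro x
    rcases x.2.2.lt_or_eq with h | h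
    · have hex : ∃ n, (x : ℝ) < t n := ⟨M, htM ▸ h⟩
      classical
      have hpos : Nat.find hex ≠ 0 := by
        intro h0
        have := Nat.find_spec hex
        rw [h0, ht0] at this
        exact this.not_ge x.2.1
      obtain ⟨n, hn⟩ := Nat.exists_eq_succ_of_ne_zero hpos
      have hnM : n < M := by
        have := Nat.find_min' hex (htM ▸ h : (x : ℝ) < t M)
        omega
      refine ⟨⟨n, by omega⟩, ?_⟩
      simp only [hV, hnM, if_true, mem_ofPred_eq]
      have hlt := Nat.find_spec hex
      rw [hn] at hlt
      exact ⟨not_lt.1 (Nat.find_min hex (by omega)), hlt⟩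
    · refine ⟨Fin.last M, ?_⟩
      simpa [hV] using Subtype.ext h
  refine (boxCount_le_card (fun i => (SeparationQuotient.mk : f.TreePoints → f.Tree) '' V i)
    ?_ ?_).trans (by simp)
  · intro p _
    obtain ⟨x, rfl⟩ := SeparationQuotient.surjective_mk p
    obtain ⟨i, hi⟩ := hVc x
    exact mem_iUnion.2 ⟨i, mem_image_of_mem _ hi⟩
  · intro i
    refine Metric.ediam_le ?_
    rintro _ ⟨x, hx, rfl⟩ _ ⟨y, hy, rfl⟩
    rw [SeparationQuotient.edist_mk, edist_dist]
    exact ENNReal.ofReal_le_ofReal (hVd i x hx y hy)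

theorem le_dist_circle {u v ρ : ℝ} (h1 : ρ ≤ v - u) (h2 : v - u ≤ 1 - ρ) :
    ρ ≤ dist (u : UnitAddCircle) (v : UnitAddCircle) := by
  rw [dist_comm, dist_eq_norm, ← AddCircle.coe_sub, UnitAddCircle.norm_eq]
  set w := v - u
  rcases le_or_gt (round w) 0 with h | h
  · have : ((round w : ℤ) : ℝ) ≤ 0 := by exact_mod_cast h
    exact le_trans (by linarith) (le_abs_self _)
  · have : (1 : ℝ) ≤ ((round w : ℤ) : ℝ) := by exact_mod_cast h
    exact le_trans (by linarith) (neg_le_abs _)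

theorem exists_eq_add_of_le_abs_sub {h : ℝ → ℝ} (hh : Continuous h) {a b δ : ℝ} (hab : a ≤ b)
    (hδ : δ ≤ |h b - h a|) :
    ∃ e : ℝ, |e| = 1 ∧ ∀ s ∈ Icc 0 δ, ∃ x ∈ Icc a b, h x = h a + e * s := by
  rcases le_total (h a) (h b) with h1 | h1
  · refine ⟨1, by simp, fun s hs => ?_⟩
    rw [abs_of_nonneg (by linarith)] at hδ
    exact intermediate_value_Icc hab hh.continuousOn ⟨by linarith [hs.1], by linarith [hs.2]⟩
  · refine ⟨-1, by simp, fun s hs => ?_⟩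
    rw [abs_of_nonpos (by linarith)] at hδ
    exact intermediate_value_Icc' hab hh.continuousOn ⟨by linarith [hs.2], by linarith [hs.1]⟩

/-- Oscillations of size `δ` over time intervals of length `ρ` contribute `δ / ρ` boxes each. -/
theorem mul_le_boxCount_circleGraph {g : C(UnitAddCircle, ℝ)} {G h : ℝ → ℝ} (hh : Continuous h)
    (hG : Monotone G) (hG0 : G 0 = 0) (hG1 : G 1 = 1)
    (hg : ∀ x ∈ Icc (0 : ℝ) 1, g (G x : UnitAddCircle) = h x) {M : ℕ} {t : ℕ → ℝ}
    (ht : Monotone t) (ht0 : t 0 = 0) (htM : t M = 1) {ρ δ : ℝ} (hρ : 0 < ρ) (hδ : 0 ≤ δ)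
    (hGt : ∀ i < M, ρ ≤ G (t (i + 1)) - G (t i))
    (hosc : ∀ i, i + 1 < M → δ ≤ |h (t (i + 1)) - h (t i)|) :
    ((M / 2 * (⌊δ / ρ⌋₊ + 1) : ℕ) : ℕ∞) ≤ boxCount (circleGraph g) (ρ / 2) := by
  have hpt : ∀ j : Fin (M / 2), ∃ e : ℝ, |e| = 1 ∧ ∀ s ∈ Icc 0 δ,
      ∃ x ∈ Icc (t (2 * j)) (t (2 * j + 1)), h x = h (t (2 * j)) + e * s := fun j =>
    exists_eq_add_of_le_abs_sub hh (ht (Nat.le_succ _)) (hosc _ (by omega))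
  choose e he hpt using hpt
  have hl : ∀ l : Fin (⌊δ / ρ⌋₊ + 1), (l : ℝ) * ρ ∈ Icc 0 δ := by
    intro l
    refine ⟨by positivity, ?_⟩
    rw [← le_div_iff₀ hρ]
    exact (Nat.le_floor_iff (by positivity)).1 (Nat.lt_succ_iff.1 l.2)
  choose x hx hhx using fun (j : Fin (M / 2)) (l : Fin (⌊δ / ρ⌋₊ + 1)) => hpt j _ (hl l)
  have hxI : ∀ j l, x j l ∈ Icc (0 : ℝ) 1 := fun j l =>
    ⟨(ht0.symm.le.trans (ht (Nat.zero_le _))).trans (hx j l).1,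
      (hx j l).2.trans (htM ▸ ht (by omega))⟩
  have key : ∀ j l j' l', j < j' → ρ ≤ dist (G (x j l) : UnitAddCircle) (G (x j' l')) := by
    intro j l j' l' hj
    have hj2 : (j : ℕ) < j' := hj
    have h1 : G (x j l) ≤ G (t (2 * j + 1)) := hG (hx j l).2
    have h2 : G (t (2 * j + 1 + 1)) ≤ G (x j' l') :=
      hG ((ht (by omega)).trans (hx j' l').1)
    have h3 := hGt (2 * j + 1) (by omega)
    have h4 : G (x j' l') ≤ G (t (2 * j' + 1)) := hG (hx j' l').2
    have h5 := hGt (2 * j' + 1) (by omega)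
    have h6 : G (t (2 * j' + 1 + 1)) ≤ 1 := hG1 ▸ htM ▸ hG (ht (by omega))
    have h7 : 0 ≤ G (x j l) := hG0 ▸ hG (hxI j l).1
    exact le_dist_circle (by linarith) (by linarith)
  have := card_le_boxCount (A := circleGraph g) (half_pos hρ).le
    (fun p : Fin (M / 2) × Fin (⌊δ / ρ⌋₊ + 1) =>
      ((G (x p.1 p.2) : UnitAddCircle), h (x p.1 p.2)))
    (fun p => ⟨(G (x p.1 p.2) : UnitAddCircle), by
      simp only [hg _ (hxI p.1 p.2)]⟩) ?_
  · simpa using this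
  rintro ⟨j, l⟩ ⟨j', l'⟩ hne
  refine (half_lt_self hρ).trans_le ?_
  rw [Prod.dist_eq]
  rcases lt_trichotomy j j' with hj | rfl | hj
  · exact (key _ _ _ _ hj).trans (le_max_left _ _)
  · refine le_trans ?_ (le_max_right _ _)
    have hll : (l : ℤ) - l' ≠ 0 := by
      intro h0
      exact hne (by rw [Fin.ext (by omega : (l : ℕ) = l')])
    have h1 : (1 : ℝ) ≤ |(l : ℝ) - l'| := by exact_mod_cast Int.one_le_abs hll
    simp only [hhx, Real.dist_eq]
    rw [show h (t (2 * j)) + e j * (l * ρ) - (h (t (2 * j)) + e j * (l' * ρ)) =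
      e j * (((l : ℝ) - l') * ρ) by ring, abs_mul, he, abs_mul, abs_of_pos hρ]
    nlinarith
  · rw [dist_comm]
    exact (key _ _ _ _ hj).trans (le_max_left _ _)

theorem continuous_circle_lift (f : C(UnitAddCircle, ℝ)) (a : UnitAddCircle) :
    Continuous fun x : ℝ => f ((x : UnitAddCircle) + a) := by
  have h : Continuous fun x : ℝ => (x : UnitAddCircle) := AddCircle.continuous_mk' 1
  fun_prop

/-- Below the box dimension `p` of the tree, `f` has at least about `δ ^ (-p)` successive
oscillations of size `δ`, for some arbitrarily small `δ`. -/
theorem exists_oscillation_scale (f : C(UnitAddCircle, ℝ)) {p : ℝ} (hp : 0 < p)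
    (hD : ENNReal.ofReal p < upperBoxDim (univ : Set (circleTree f))) (n : ℕ) :
    ∃ (M : ℕ) (t : ℕ → ℝ) (δ : ℝ), 0 < δ ∧ Monotone t ∧ t 0 = 0 ∧ t M = 1 ∧
      (∀ i < M, t i < t (i + 1)) ∧
      (∀ i, i + 1 < M → δ ≤ |f ((t (i + 1) : UnitAddCircle) + circleArgmin f) -
        f ((t i : UnitAddCircle) + circleArgmin f)|) ∧
      n ≤ M ∧ (4 * δ) ^ (-p) ≤ M + 1 := by
  have hfreq := frequently_lt_of_lt_limsup (by isBoundedDefault) hD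
  have hev : ∀ᶠ r : ℝ in 𝓝[>] 0, (n : ℝ) + 1 ≤ r ^ (-p) :=
    (tendsto_rpow_neg_nhdsGT_zero (neg_neg_of_pos hp)).eventually_ge_atTop _
  have hev1 : ∀ᶠ r : ℝ in 𝓝[>] 0, r ∈ Ioo (0 : ℝ) 1 := Ioo_mem_nhdsGT one_pos
  obtain ⟨r, hr, hrn, hr0, hr1⟩ := (hfreq.and_eventually (hev.and hev1)).exists
  obtain ⟨M, t, ht, ht0, htM, hlt, hosc, hosc'⟩ :=
    exists_oscillation_partition (continuous_circle_lift f (circleArgmin f)) (δ := r / 4)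
      (by positivity)
  have h4 : 4 * (r / 4) = r := by ring
  have hM : r ^ (-p) ≤ M + 1 := by
    have h1 := ofReal_rpow_neg_le_of_lt_log_div hr0 hr1 hr
    have h2 := (circleExcursion f).boxCount_tree_le (M := M) (t := t) (δ := r / 4)
      (by positivity) (c := fun i => f ((t i : UnitAddCircle) + circleArgmin f) -
        f (circleArgmin f)) ht0 htM (fun i hi x hx => by
        have := (hosc' i hi x hx).le
        simpa [circleExcursion] using this)
    rw [h4, ← ENat.toENNReal_le] at h2
    have h3 := h1.trans h2
    rw [ENat.toENNReal_coe, ENNReal.ofReal_le_natCast] at h3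
    simpa using h3
  refine ⟨M, t, r / 4, by positivity, ht, ht0, htM, hlt, hosc, ?_, by rwa [h4]⟩
  have : (n : ℝ) + 1 ≤ M + 1 := hrn.trans hM
  exact_mod_cast (by linarith : (n : ℝ) ≤ M)

theorem rpow_neg_le_half_mul_floor {M k : ℕ} {p δ s : ℝ} (hp : 0 < p) (hδ : 0 < δ)
    (hM : 2 ^ ((k + 8) * (k + 1)) ≤ M) (hδM : (4 * δ) ^ (-p) ≤ M + 1)
    (hs : s = (1 / 2) ^ (k + 2) / M / 2) :
    s ^ (-(2 - 1 / p - 1 / (k + 1))) ≤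
      ((M / 2 * (⌊δ / ((1 / 2) ^ (k + 2) / M)⌋₊ + 1) : ℕ) : ℝ) := by
  have hM2 : 2 ≤ M := le_trans (Nat.le_self_pow (by positivity) 2) hM
  have hM0 : (0 : ℝ) < M := by exact_mod_cast (by omega : 0 < M)
  have hs0 : 0 < s := by rw [hs]; positivity
  have hsM : s * M = (1 / 2) ^ (k + 3) := by rw [hs]; field_simp; ring
  have hk : ((1 : ℝ) / 2) ^ (k + 3) ≤ 1 / 2 := by
    calc ((1 : ℝ) / 2) ^ (k + 3) ≤ (1 / 2) ^ 1 :=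
          pow_le_pow_of_le_one (by norm_num) (by norm_num) (by omega)
      _ = 1 / 2 := pow_one _
  have hsδ : s ^ (1 / p) ≤ 4 * δ := by
    by_contra hcon
    have h1 := Real.rpow_lt_rpow_of_neg (by positivity) (not_le.1 hcon) (neg_neg_of_pos hp)
    rw [← Real.rpow_mul hs0.le, show 1 / p * -p = -1 by field_simp, Real.rpow_neg_one] at h1
    have h2 : (M : ℝ) + 1 ≤ s⁻¹ := by
      rw [← one_div, le_div_iff₀ hs0]
      have : (1 : ℝ) ≤ M := by exact_mod_cast (by omega : 1 ≤ M)
      nlinarith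
    linarith
  have hsk : s ^ (1 / ((k : ℝ) + 1)) ≤ (1 / 2) ^ (k + 8) := by
    have h1 : s ≤ ((1 / 2) ^ (k + 8)) ^ ((k : ℝ) + 1) := by
      rw [show (k : ℝ) + 1 = ((k + 1 : ℕ) : ℝ) by push_cast; rfl, Real.rpow_natCast, ← pow_mul,
        one_div, inv_pow, ← one_div, le_div_iff₀ (by positivity)]
      have : (2 : ℝ) ^ ((k + 8) * (k + 1)) ≤ M := by exact_mod_cast hM
      nlinarith
    calc s ^ (1 / ((k : ℝ) + 1)) ≤ (((1 / 2) ^ (k + 8)) ^ ((k : ℝ) + 1)) ^ (1 / ((k : ℝ) + 1)) :=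
          Real.rpow_le_rpow hs0.le h1 (by positivity)
      _ = (1 / 2) ^ (k + 8) := by
        rw [← Real.rpow_mul (by positivity), mul_one_div_cancel (by positivity), Real.rpow_one]
  have hfl : δ / (2 * s) ≤ ⌊δ / ((1 / 2) ^ (k + 2) / M)⌋₊ + 1 := by
    rw [show (2 : ℝ) * s = (1 / 2) ^ (k + 2) / M by rw [hs]; ring]
    exact (Nat.lt_floor_add_one _).le
  have hhalf : (M : ℝ) / 4 ≤ ((M / 2 : ℕ) : ℝ) := by
    have : M ≤ 4 * (M / 2) := by omega
    have : (M : ℝ) ≤ 4 * ((M / 2 : ℕ) : ℝ) := by exact_mod_cast this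
    linarith
  calc s ^ (-(2 - 1 / p - 1 / ((k : ℝ) + 1)))
      = s ^ (-2 : ℝ) * (s ^ (1 / p) * s ^ (1 / ((k : ℝ) + 1))) := by
        rw [← Real.rpow_add hs0, ← Real.rpow_add hs0]; congr 1; ring
    _ ≤ s ^ (-2 : ℝ) * (4 * δ * (1 / 2) ^ (k + 8)) := by gcongr
    _ = M / 4 * (δ / (2 * s)) := by
        rw [Real.rpow_neg hs0.le, Real.rpow_two,
          show ((1 : ℝ) / 2) ^ (k + 8) = s * M * (1 / 32) by rw [hsM]; ring]
        field_simp
        ring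
    _ ≤ ((M / 2 : ℕ) : ℝ) * (⌊δ / ((1 / 2) ^ (k + 2) / M)⌋₊ + 1) := by gcongr
    _ = _ := by push_cast; rfl

theorem le_upperBoxDim_of_tendsto {X : Type*} [PseudoMetricSpace X] {A : Set X} {s q : ℕ → ℝ}
    {c : ℝ≥0∞} (hs : ∀ k, s k ∈ Ioo (0 : ℝ) 1) (hs0 : Tendsto s atTop (𝓝 0))
    (hq : Tendsto (fun k => ENNReal.ofReal (q k)) atTop (𝓝 c))
    (h : ∀ k, ENNReal.ofReal (s k ^ (-q k)) ≤ ((boxCount A (s k) : ℕ∞) : ℝ≥0∞)) :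
    c ≤ upperBoxDim A := by
  refine le_of_forall_lt fun b hb => ?_
  obtain ⟨b', hbb', hb'⟩ := exists_between hb
  refine hbb'.trans_le (le_limsup_of_frequently_le ?_ (by isBoundedDefault))
  have hs' : Tendsto s atTop (𝓝[>] 0) :=
    tendsto_nhdsWithin_iff.2 ⟨hs0, Eventually.of_forall fun k => (hs k).1⟩
  refine hs'.frequently (Eventually.frequently ?_)
  filter_upwards [hq.eventually (lt_mem_nhds hb')] with k hk
  exact hk.le.trans (ofReal_le_log_div_of_rpow_neg_le (hs k).1 (hs k).2 (h k))

theorem mainTheorem5 (f : C(UnitAddCircle, ℝ)) (hf : ¬ ∃ c : ℝ, ∀ x, f x = c) :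
    ∃ τ : UnitAddCircle ≃ₜ UnitAddCircle,
      2 - 1 / modifiedUpperBoxDim (circleTree f) ≤
        upperBoxDim (circleGraph (f.comp (τ : C(UnitAddCircle, UnitAddCircle)))) := by
  set D := modifiedUpperBoxDim (circleTree f) with hD
  rcases eq_or_ne D 0 with h0 | h0
  · exact ⟨Homeomorph.refl _, by simp [h0]⟩
  obtain ⟨u, -, hu, hulim⟩ := exists_seq_strictMono_tendsto' (pos_iff_ne_zero.2 h0)
  have hutop : ∀ k, u k ≠ ⊤ := fun k => (hu k).2.ne_top
  have hu0 : ∀ k, 0 < (u k).toReal := fun k => ENNReal.toReal_pos (hu k).1.ne' (hutop k)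
  choose M t δ hδ ht ht0 htM hlt hosc hM hδM using fun k =>
    exists_oscillation_scale f (hu0 k) (by
      rw [ENNReal.ofReal_toReal (hutop k)]
      exact (hu k).2.trans_le (modifiedUpperBoxDim_le_upperBoxDim_univ _))
      (2 ^ ((k + 8) * (k + 1)))
  have hM0 : ∀ k, M k ≠ 0 := fun k => by
    have := hM k; have := Nat.one_le_two_pow (n := (k + 8) * (k + 1)); omega
  have hM0' : ∀ k, (1 : ℝ) ≤ M k := fun k => by exact_mod_cast Nat.one_le_iff_ne_zero.2 (hM0 k)
  obtain ⟨G, hGc, hGm, hG0, hG1, hGt⟩ := exists_time_change M t hM0 ht ht0 htM hlt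
  obtain ⟨φ, hφ⟩ := exists_circle_homeomorph hGc hGm hG0 hG1
  refine ⟨φ.symm.trans (Homeomorph.addRight (circleArgmin f)), ?_⟩
  set ρ : ℕ → ℝ := fun k => (1 / 2) ^ (k + 2) / M k with hρ
  have hρ0 : ∀ k, 0 < ρ k := fun k => by have := hM0' k; simp only [hρ]; positivity
  have hρ1 : ∀ k, ρ k / 2 ≤ (1 / 2) ^ (k + 3) := fun k => by
    have : ρ k ≤ (1 / 2) ^ (k + 2) := div_le_self (by positivity) (hM0' k)
    rw [pow_succ]; linarith
  refine le_upperBoxDim_of_tendsto (s := fun k => ρ k / 2)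
    (q := fun k => 2 - 1 / (u k).toReal - 1 / (k + 1)) (fun k => ⟨half_pos (hρ0 k), ?_⟩) ?_ ?_ ?_
  · exact (hρ1 k).trans_lt (pow_lt_one₀ (by norm_num) (by norm_num) (by omega))
  · refine squeeze_zero (fun k => (half_pos (hρ0 k)).le) hρ1 ?_
    exact (tendsto_pow_atTop_nhds_zero_of_lt_one (by norm_num) (by norm_num)).comp
      (tendsto_add_atTop_nat 3)
  · have heq : (fun k : ℕ => ENNReal.ofReal (2 - 1 / (u k).toReal - 1 / (k + 1))) =
        fun k : ℕ => 2 - 1 / u k - ENNReal.ofReal (1 / (k + 1)) := by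
      funext k
      rw [ENNReal.ofReal_sub _ (by positivity), ENNReal.ofReal_sub _ (by positivity),
        ENNReal.ofReal_div_of_pos (hu0 k), ENNReal.ofReal_toReal (hutop k)]
      simp
    rw [heq]
    have h1 : Tendsto (fun k => 2 - 1 / u k) atTop (𝓝 (2 - 1 / D)) := by
      simp only [one_div]
      exact ENNReal.Tendsto.sub tendsto_const_nhds (tendsto_inv_iff.2 hulim)
        (Or.inl (by simp))
    have h2 : Tendsto (fun k : ℕ => ENNReal.ofReal (1 / ((k : ℝ) + 1))) atTop (𝓝 0) := by
      simpa using ENNReal.tendsto_ofReal tendsto_one_div_add_atTop_nhds_zero_nat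
    simpa using ENNReal.Tendsto.sub h1 h2 (Or.inr (by simp))
  · intro k
    have h1 := rpow_neg_le_half_mul_floor (hu0 k) (hδ k) (hM k) (hδM k) rfl
    have h2 := mul_le_boxCount_circleGraph
      (g := f.comp (φ.symm.trans (Homeomorph.addRight (circleArgmin f)) :
        C(UnitAddCircle, UnitAddCircle)))
      (continuous_circle_lift f (circleArgmin f)) hGm.monotone hG0 hG1
      (fun x hx => by simp [← hφ x hx]) (ht k) (ht0 k) (htM k) (hρ0 k) (hδ k).le (hGt k) (hosc k)
    rw [← ENat.toENNReal_le, ENat.toENNReal_coe] at h2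
    refine le_trans ?_ h2
    exact ENNReal.ofReal_le_natCast.2 h1
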